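/- Let $\mathcal{M}$ be a finite index set with $M$ elements, let $\Lambda_m>0$ for each $m\in\mathcal{M}$, and let $\varphi_m:\mathcal{X}\to\mathbb{R}$ $(m\in\mathcal{M})$ be measurable feature functions. For $\boldsymbol\theta\in\mathbb{R}^{M}$ put $$E_{\boldsymbol\theta}(x)=\sum_{m\in\mathcal{M}}\theta_m\varphi_m(x),\qquad Z_{\boldsymbol\theta}=\int_{\mathcal{X}}e^{-E_{\boldsymbol\theta}(x)}\,dx,\qquad \eta_m(\boldsymbol\theta)=\frac{1}{Z_{\boldsymbol\theta}}\int_{\mathcal{X}}\varphi_m(x)\,e^{-E_{\boldsymbol\theta}(x)}\,dx,$$ where $dx$ is Lebesgue measure if $\mathcal{X}\subset\mathbb{R}^N$, and the integrals are replaced by sums over $\mathcal{X}$ if $\mathcal{X}$ is discrete. Suppose that either (i) $\mathcal{X}$ is a nonempty finite discrete space, or (ii) $\mathcal{X}$ is a bounded closed subset of some Euclidean space $\mathbb{R}^N$ with positive Lebesgue measure, and every $\varphi_m$ is a bounded function on $\mathcal{X}$. Then for every $\boldsymbol\mu\in\mathbb{R}^{M}$ there exists $\boldsymbol\theta^*\in\mathbb{R}^{M}$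 such that the integrals (sums) defining $Z_{\boldsymbol\theta^*}$ and all $\eta_m(\boldsymbol\theta^*)$ are finite, $Z_{\boldsymbol\theta^*}>0$, and $$\theta^*_m=\Lambda_m\bigl(\eta_m(\boldsymbol\theta^*)-\mu_m\bigr)\qquad\text{for all } m\in\mathcal{M}.$$ -/

import Mathlib

open MeasureTheory

noncomputable section

namespace Gibbs

variable {M X : Type*} [Fintype M] [MeasurableSpace X]

/-- The energy `E_θ(x) = ∑ m, θ_m φ_m(x)` of a point, for feature functions `φ_m`. -/
def energy (φ : M → X → ℝ) (θ : M → ℝ) (x : X) : ℝ :=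
  ∑ m, θ m * φ m x

/-- The partition function `Z_θ = ∫ exp (-E_θ(x)) dx`. The reference measure `ν` is Lebesgue
measure on a subset of Euclidean space, and counting measure (so that the integral is a sum) on a
discrete space. -/
def partitionFunction (ν : Measure X) (φ : M → X → ℝ) (θ : M → ℝ) : ℝ :=
  ∫ x, Real.exp (-energy φ θ x) ∂ν

/-- The mean `η_m(θ) = Z_θ⁻¹ ∫ φ_m(x) exp (-E_θ(x)) dx` of the feature `φ_m` under the Gibbs
distribution with parameter `θ`. -/
def featureMean (ν : Measure X) (φ : M → X → ℝ) (θ : M → ℝ) (m : M) : ℝ :=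
  1 / partitionFunction ν φ θ * ∫ x, φ m x * Real.exp (-energy φ θ x) ∂ν

/-- The set of parameters for which the integrals that define `Z_θ` and all `η_m(θ)` are finite. -/
def paramDomain (ν : Measure X) (φ : M → X → ℝ) : Set (M → ℝ) :=
  {θ | Integrable (fun x => Real.exp (-energy φ θ x)) ν ∧
    ∀ m, Integrable (fun x => φ m x * Real.exp (-energy φ θ x)) ν}

/-- `θ` solves `θ_m = Λ_m (η_m(θ) - μ_m)` for all `m`. It is part of being a solution that the Gibbs
distribution with parameter `θ` and its feature means are well defined. -/
def IsSolution (ν : Measure X) (φ : M → X → ℝ) (Λ μ θ : M → ℝ) : Prop :=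
  θ ∈ paramDomain ν φ ∧ 0 < partitionFunction ν φ θ ∧
    ∀ m, θ m = Λ m * (featureMean ν φ θ m - μ m)

/-- On a finite discrete space with counting measure the partition function is a sum. -/
theorem partitionFunction_count [Fintype X] [DiscreteMeasurableSpace X]
    (φ : M → X → ℝ) (θ : M → ℝ) :
    partitionFunction Measure.count φ θ = ∑ x, Real.exp (-energy φ θ x) := by
  simp [partitionFunction, integral_count]

/-- On a finite discrete space with counting measure the feature means are quotients of sums. -/
theorem featureMean_count [Fintype X] [DiscreteMeasurableSpace X]
    (φ : M → X → ℝ) (θ : M → ℝ) (m : M) :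
    featureMean Measure.count φ θ m =
      1 / (∑ x, Real.exp (-energy φ θ x)) * ∑ x, φ m x * Real.exp (-energy φ θ x) := by
  simp [featureMean, partitionFunction_count, integral_count]

end Gibbs

end

open Filter Topology

namespace Gibbs

variable {M X : Type*} [Fintype M]

/-! The equations say that `θ` is a critical point of `F(θ) = log Z_θ + ∑ m, (θ_m² / (2 Λ_m) + θ_m
μ_m)`, because `∂_m log Z_θ = -η_m(θ)`. For features bounded by `C` and a finite nonzero measure
`ν`, `le_partitionFunction` gives `log Z_θ ≥ log ν(X) - C ∑ m, |θ_m|`. The quadratic term beats this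
linear loss, so `F` is coercive (`tendsto_potential_cocompact`). Being continuous, it attains a
minimum, where all its partial derivatives (`hasDerivAt_potential`) vanish. Both kinds of space are
instances of this setting. -/

theorem continuous_energy (φ : M → X → ℝ) (x : X) : Continuous fun θ => energy φ θ x := by
  unfold energy
  fun_prop

theorem abs_energy_le {φ : M → X → ℝ} {C : ℝ} (hC : ∀ m x, |φ m x| ≤ C) (θ : M → ℝ) (x : X) :
    |energy φ θ x| ≤ C * ∑ m, |θ m| := by
  unfold energy
  refine (Finset.abs_sum_le_sum_abs _ _).trans ?_
  rw [Finset.mul_sum]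
  refine Finset.sum_le_sum fun m _ => ?_
  rw [abs_mul, mul_comm]
  exact mul_le_mul_of_nonneg_right (hC m x) (abs_nonneg _)

theorem energy_add_single [DecidableEq M] (φ : M → X → ℝ) (θ : M → ℝ) (m : M) (t : ℝ) (x : X) :
    energy φ (θ + Pi.single m t) x = energy φ θ x + t * φ m x := by
  simp [energy, add_mul, Finset.sum_add_distrib, Pi.single_apply]

variable [MeasurableSpace X]

theorem measurable_energy {φ : M → X → ℝ} (hφ : ∀ m, Measurable (φ m)) (θ : M → ℝ) :
    Measurable (energy φ θ) := by
  unfold energy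
  fun_prop

section Bounded

variable {ν : Measure X} [IsFiniteMeasure ν] {φ : M → X → ℝ} {C : ℝ}

theorem integrable_exp_neg_energy (hφ : ∀ m, Measurable (φ m)) (hC : ∀ m x, |φ m x| ≤ C)
    (θ : M → ℝ) : Integrable (fun x => Real.exp (-energy φ θ x)) ν := by
  refine Integrable.of_bound (C := Real.exp (C * ∑ m, |θ m|))
    (measurable_energy hφ θ).neg.exp.aestronglyMeasurable (.of_forall fun x => ?_)
  rw [Real.norm_eq_abs, Real.abs_exp]
  exact Real.exp_le_exp.2 ((neg_le_abs _).trans (abs_energy_le hC θ x))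

theorem integrable_mul_exp_neg_energy (hφ : ∀ m, Measurable (φ m)) (hC : ∀ m x, |φ m x| ≤ C)
    (θ : M → ℝ) (m : M) : Integrable (fun x => φ m x * Real.exp (-energy φ θ x)) ν :=
  (integrable_exp_neg_energy hφ hC θ).bdd_mul (hφ m).aestronglyMeasurable (.of_forall (hC m))

theorem le_partitionFunction (hφ : ∀ m, Measurable (φ m)) (hC : ∀ m x, |φ m x| ≤ C)
    (θ : M → ℝ) : ν.real Set.univ * Real.exp (-(C * ∑ m, |θ m|)) ≤ partitionFunction ν φ θ := by
  have h := integral_mono (μ := ν) (integrable_const (Real.exp (-(C * ∑ m, |θ m|))))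
    (integrable_exp_neg_energy hφ hC θ)
    (fun x => Real.exp_le_exp.2 (neg_le_neg ((le_abs_self _).trans (abs_energy_le hC θ x))))
  simpa [partitionFunction] using h

theorem partitionFunction_pos [NeZero ν] (hφ : ∀ m, Measurable (φ m)) (hC : ∀ m x, |φ m x| ≤ C)
    (θ : M → ℝ) : 0 < partitionFunction ν φ θ :=
  (mul_pos (measureReal_univ_pos) (Real.exp_pos _)).trans_le
    (le_partitionFunction hφ hC θ)

theorem continuous_partitionFunction (hφ : ∀ m, Measurable (φ m)) (hC : ∀ m x, |φ m x| ≤ C) :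
    Continuous (partitionFunction ν φ) := by
  refine continuous_iff_continuousAt.2 fun θ₀ => ?_
  have hc : Continuous fun θ : M → ℝ => C * ∑ m, |θ m| := by fun_prop
  -- The exponent bound `C * ∑ m, |θ m|` is continuous in `θ`, so near `θ₀` it exceeds its value
  -- there by less than 1.
  refine continuousAt_of_dominated (bound := fun _ => Real.exp (C * ∑ m, |θ₀ m| + 1))
    (.of_forall fun θ => (integrable_exp_neg_energy hφ hC θ).aestronglyMeasurable) ?_
    (integrable_const _)
    (.of_forall fun x => (continuous_energy φ x).neg.rexp.continuousAt)
  filter_upwards [hc.continuousAt.eventually_lt continuousAt_const (lt_add_one _)] with θ hθ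
  refine .of_forall fun x => ?_
  rw [Real.norm_eq_abs, Real.abs_exp]
  exact Real.exp_le_exp.2 (((neg_le_abs _).trans (abs_energy_le hC θ x)).trans hθ.le)

theorem hasDerivAt_partitionFunction [DecidableEq M] (hφ : ∀ m, Measurable (φ m))
    (hC : ∀ m x, |φ m x| ≤ C) (θ : M → ℝ) (m : M) :
    HasDerivAt (fun t : ℝ => partitionFunction ν φ (θ + Pi.single m t))
      (-∫ x, φ m x * Real.exp (-energy φ θ x) ∂ν) 0 := by
  have hE : ∀ t : ℝ, energy φ (θ + Pi.single m t) = fun x => energy φ θ x + t * φ m x :=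
    fun t => funext (energy_add_single φ θ m t)
  -- For `|t| < 1` the shift changes the energy by at most `C`, so a constant dominates the
  -- derivative; it is integrable as `ν` is finite.
  have hB : ∀ x, ∀ t ∈ Metric.ball (0 : ℝ) 1,
      ‖-(φ m x * Real.exp (-(energy φ θ x + t * φ m x)))‖ ≤
        C * Real.exp (C * ∑ i, |θ i| + C) := by
    intro x t ht
    have hC0 : 0 ≤ C := (abs_nonneg _).trans (hC m x)
    rw [norm_neg, norm_mul, Real.norm_eq_abs, Real.norm_eq_abs, Real.abs_exp]
    refine mul_le_mul (hC m x) (Real.exp_le_exp.2 ?_) (Real.exp_pos _).le hC0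
    rw [neg_add]
    refine add_le_add ((neg_le_abs _).trans (abs_energy_le hC θ x)) ((neg_le_abs _).trans ?_)
    rw [abs_mul]
    have ht' : |t| ≤ 1 := by simpa using (mem_ball_zero_iff.1 ht).le
    exact (mul_le_of_le_one_left (abs_nonneg _) ht').trans (hC m x)
  have hF : ∀ t : ℝ, Integrable (fun x => Real.exp (-(energy φ θ x + t * φ m x))) ν := fun t => by
    have h := integrable_exp_neg_energy (ν := ν) hφ hC (θ + Pi.single m t)
    rwa [hE] at h
  have hF' : AEStronglyMeasurable
      (fun x => -(φ m x * Real.exp (-(energy φ θ x + 0 * φ m x)))) ν := by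
    simpa only [zero_mul, add_zero] using
      (integrable_mul_exp_neg_energy hφ hC θ m).aestronglyMeasurable.fun_neg
  have hd : ∀ x, ∀ t ∈ Metric.ball (0 : ℝ) 1,
      HasDerivAt (fun t : ℝ => Real.exp (-(energy φ θ x + t * φ m x)))
        (-(φ m x * Real.exp (-(energy φ θ x + t * φ m x)))) t := by
    intro x t _
    have h : HasDerivAt (fun t : ℝ => -(energy φ θ x + t * φ m x)) (-φ m x) t := by
      simpa using (((hasDerivAt_id t).mul_const (φ m x)).const_add (energy φ θ x)).fun_neg
    refine h.exp.congr_deriv ?_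
    ring
  have key := (hasDerivAt_integral_of_dominated_loc_of_deriv_le (μ := ν)
    (Metric.ball_mem_nhds (0 : ℝ) one_pos) (.of_forall fun t => (hF t).aestronglyMeasurable)
    (hF 0) hF' (.of_forall hB) (integrable_const _) (.of_forall hd)).2
  simp only [zero_mul, add_zero, integral_neg] at key
  simpa only [partitionFunction, hE] using key

/-- The convex potential whose critical points are the solutions of `θ_m = Λ_m (η_m(θ) - μ_m)`. -/
noncomputable def potential (ν : Measure X) (φ : M → X → ℝ) (Λ μ θ : M → ℝ) : ℝ :=
  Real.log (partitionFunction ν φ θ) + ∑ m, (θ m ^ 2 / (2 * Λ m) + θ m * μ m)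

theorem continuous_potential [NeZero ν] (hφ : ∀ m, Measurable (φ m)) (hC : ∀ m x, |φ m x| ≤ C)
    (Λ μ : M → ℝ) : Continuous (potential ν φ Λ μ) := by
  unfold potential
  refine ((continuous_partitionFunction hφ hC).log
    fun θ => (partitionFunction_pos hφ hC θ).ne').add ?_
  fun_prop

/-- Completing the square in `|t|`. `K` is the slope of the linear loss from `log Z`; the `+ 1`
leaves a surplus `|t|` that makes the potential grow. -/
theorem abs_sub_le_quadratic {l : ℝ} (hl : 0 < l) (K u t : ℝ) :
    |t| - l * (K + |u| + 1) ^ 2 / 2 ≤ t ^ 2 / (2 * l) + t * u - K * |t| := by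
  have h1 : -(|t| * |u|) ≤ t * u := by
    rw [← abs_mul]
    exact neg_abs_le _
  have h2 : t ^ 2 / (2 * l) + l * (K + |u| + 1) ^ 2 / 2 - (K + |u| + 1) * |t| =
      (|t| - l * (K + |u| + 1)) ^ 2 / (2 * l) := by
    rw [← sq_abs t]
    field_simp
    ring
  have h3 : 0 ≤ (|t| - l * (K + |u| + 1)) ^ 2 / (2 * l) := by positivity
  linarith

theorem tendsto_potential_cocompact [NeZero ν] (hφ : ∀ m, Measurable (φ m))
    (hC : ∀ m x, |φ m x| ≤ C) {Λ : M → ℝ} (hΛ : ∀ m, 0 < Λ m) (μ : M → ℝ) :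
    Tendsto (potential ν φ Λ μ) (cocompact (M → ℝ)) atTop := by
  refine tendsto_atTop_mono (f := fun θ : M → ℝ => (Real.log (ν.real Set.univ) -
    ∑ m, Λ m * (C + |μ m| + 1) ^ 2 / 2) + ‖θ‖) (fun θ => ?_)
    (tendsto_atTop_add_const_left _ _ tendsto_norm_cocompact_atTop)
  have hV : 0 < ν.real Set.univ := measureReal_univ_pos
  have hlog := Real.log_le_log (mul_pos hV (Real.exp_pos _)) (le_partitionFunction (ν := ν) hφ hC θ)
  rw [Real.log_mul hV.ne' (Real.exp_pos _).ne', Real.log_exp] at hlog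
  have hq := Finset.sum_le_sum fun m (_ : m ∈ Finset.univ) =>
    abs_sub_le_quadratic (hΛ m) C (μ m) (θ m)
  rw [Finset.sum_sub_distrib, Finset.sum_sub_distrib, ← Finset.mul_sum] at hq
  -- The surplus is an ℓ¹ norm, which dominates the sup norm of `M → ℝ`.
  have hn : ‖θ‖ ≤ ∑ m, |θ m| :=
    (pi_norm_le_iff_of_nonneg (Finset.sum_nonneg fun _ _ => abs_nonneg _)).2 fun m =>
      Finset.single_le_sum (f := fun i => |θ i|) (fun _ _ => abs_nonneg _) (Finset.mem_univ m)
  unfold potential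
  linarith

theorem hasDerivAt_potential [DecidableEq M] [NeZero ν] (hφ : ∀ m, Measurable (φ m))
    (hC : ∀ m x, |φ m x| ≤ C) (Λ μ θ : M → ℝ) (m : M) :
    HasDerivAt (fun t : ℝ => potential ν φ Λ μ (θ + Pi.single m t))
      (-featureMean ν φ θ m + (θ m / Λ m + μ m)) 0 := by
  have h0 : θ + Pi.single m (0 : ℝ) = θ := by simp
  have hlog := (hasDerivAt_partitionFunction (ν := ν) hφ hC θ m).log
    (partitionFunction_pos hφ hC _).ne'
  have hsum : HasDerivAt
      (fun t : ℝ => ∑ i, ((θ + Pi.single m t : M → ℝ) i ^ 2 / (2 * Λ i) +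
        (θ + Pi.single m t : M → ℝ) i * μ i))
      (∑ i, if i = m then θ i / Λ i + μ i else 0) 0 := by
    refine HasDerivAt.fun_sum fun i _ => ?_
    by_cases hi : i = m
    · subst hi
      have h : HasDerivAt (fun t : ℝ => θ i + t) 1 0 := (hasDerivAt_id 0).const_add (θ i)
      have h' := ((h.pow 2).div_const (2 * Λ i)).add (h.mul_const (μ i))
      simp only [Pi.add_apply, Pi.single_eq_same, if_true]
      refine h'.congr_deriv ?_
      simp [mul_div_mul_left]
    · simp only [Pi.add_apply, Pi.single_eq_of_ne hi, if_neg hi]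
      exact hasDerivAt_const _ _
  refine (hlog.add hsum).congr_deriv ?_
  simp only [h0, Finset.sum_ite_eq', Finset.mem_univ, if_true, featureMean]
  ring

theorem exists_isSolution [NeZero ν] (hφ : ∀ m, Measurable (φ m)) (hC : ∀ m x, |φ m x| ≤ C)
    {Λ : M → ℝ} (hΛ : ∀ m, 0 < Λ m) (μ : M → ℝ) : ∃ θ, IsSolution ν φ Λ μ θ := by
  classical
  obtain ⟨θ, hθ⟩ := (continuous_potential (ν := ν) hφ hC Λ μ).exists_forall_le
    (tendsto_potential_cocompact hφ hC hΛ μ)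
  refine ⟨θ, ⟨integrable_exp_neg_energy hφ hC θ, integrable_mul_exp_neg_energy hφ hC θ⟩,
    partitionFunction_pos hφ hC θ, fun m => ?_⟩
  -- A global minimum remains one on each coordinate line through `θ`, so one-variable derivatives
  -- suffice.
  have hmin : IsLocalMin (fun t : ℝ => potential ν φ Λ μ (θ + Pi.single m t)) 0 :=
    .of_forall fun t => by simpa using hθ (θ + Pi.single m t)
  have h := hmin.hasDerivAt_eq_zero (hasDerivAt_potential hφ hC Λ μ θ m)
  have h' : featureMean ν φ θ m - μ m = θ m / Λ m := by linarith
  rw [h', mul_div_cancel₀ _ (hΛ m).ne']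

end Bounded

end Gibbs

theorem corollary1 {M : Type*} [Fintype M] (Λ : M → ℝ) (hΛ : ∀ m, 0 < Λ m) :
    -- finite discrete spaces, with counting measure
    (∀ (X : Type*) [Finite X] [Nonempty X] [MeasurableSpace X] [DiscreteMeasurableSpace X]
      (φ : M → X → ℝ) (μ : M → ℝ),
      ∃ θ : M → ℝ, Gibbs.IsSolution (Measure.count : Measure X) φ Λ μ θ) ∧
    -- bounded closed subsets of Euclidean space, with Lebesgue measure
    (∀ (N : ℕ) (X : Set (EuclideanSpace ℝ (Fin N))),
      Bornology.IsBounded X → IsClosed X → 0 < volume X →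
      ∀ φ : M → X → ℝ, (∀ m, Measurable (φ m)) → (∀ m, ∃ C : ℝ, ∀ x, |φ m x| ≤ C) →
      ∀ μ : M → ℝ,
      ∃ θ : M → ℝ, Gibbs.IsSolution (Measure.comap Subtype.val volume : Measure X) φ Λ μ θ) := by

  constructor
  · intro X _ _ _ _ φ μ
    cases nonempty_fintype X
    refine Gibbs.exists_isSolution (C := ∑ m, ∑ x, |φ m x|) (fun m => .of_discrete)
      (fun m x => ?_) hΛ μ
    exact (Finset.single_le_sum (f := fun y => |φ m y|) (fun _ _ => abs_nonneg _)
      (Finset.mem_univ x)).trans (Finset.single_le_sum (f := fun i => ∑ y, |φ i y|)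
        (fun _ _ => Finset.sum_nonneg fun _ _ => abs_nonneg _) (Finset.mem_univ m))
  · intro N X hb hc hpos φ hφ hbdd μ
    choose C hC using hbdd
    -- Closedness makes `X` measurable, so the total mass is `volume X`: finite by boundedness,
    -- nonzero by positivity.
    have huniv : (Measure.comap Subtype.val volume : Measure X) Set.univ = volume X := by
      rw [comap_subtype_coe_apply hc.measurableSet, Set.image_univ, Subtype.range_coe]
    have : IsFiniteMeasure (Measure.comap Subtype.val volume : Measure X) :=
      ⟨huniv ▸ hb.measure_lt_top⟩
    have : NeZero (Measure.comap Subtype.val volume : Measure X) :=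
      ⟨fun h => hpos.ne' (by rw [← huniv, h, Measure.coe_zero, Pi.zero_apply])⟩
    -- Summing the absolute values of the separate bounds gives one bound for all features, even
    -- when `M` is empty.
    refine Gibbs.exists_isSolution (C := ∑ m, |C m|) hφ (fun m x => ?_) hΛ μ
    exact ((hC m x).trans (le_abs_self _)).trans (Finset.single_le_sum (f := fun i => |C i|)
      (fun _ _ => abs_nonneg _) (Finset.mem_univ m))
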